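/- Let $x_1,x_2,w\in\mathbb C$ with $\operatorname{Re}x_1>0$, $\operatorname{Re}x_2>0$ and $\operatorname{Re}(x_1/x_2)>0$, and suppose that $x_2^2n^2+x_1^2k^2\neq -w^2$ for all integers $n\ge 1$ and $k\ge 0$. For every $n\ge1$ let $s_n$ and $r_n$ be square roots of $n^2x_1^2+w^2$ and $n^2x_2^2+w^2$, respectively, equal to the principal ones for all but finitely many $n$ (for instance, for all $n$). Then the products and the series below converge (unconditionally), the product in the denominator on the left is not $0$, and $$\frac{\prod_{n\ge1}\bigl(1-e^{-\frac{2\pi}{x_2}s_n}\bigr)}{\prod_{n\ge1}\bigl(1-e^{-\frac{2\pi}{x_1}r_n}\bigr)}=\Bigl(\frac{x_1}{x_2}\Bigr)^{\frac{\pi w^2}{2x_1x_2}}\;Q\;\exp\Bigl\{\frac{\pi}{12}\Bigl(\frac{x_1}{x_2}-\frac{x_2}{x_1}\Bigr)+\pi\sum_{n\ge1}\Bigl(\frac{r_n}{x_1}-\frac{s_n}{x_2}-\frac{x_2n}{x_1}+\frac{x_1n}{x_2}\Bigr)\Bigr\},$$ where the power is the principal one and $Q$ is the following square root of $\sinh(\pi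 w/x_1)/\sinh(\pi w/x_2)$ (to be read as $x_2/x_1$ at $w=0$): $$Q=\sqrt{\frac{x_2}{x_1}}\;\prod_{n\ge1}\frac{s_n/(nx_1)}{r_n/(nx_2)},\qquad Q^2=\frac{\sinh(\pi w/x_1)}{\sinh(\pi w/x_2)},$$ with the principal value of $\sqrt{x_2/x_1}$. In particular, if $x_1,x_2>0$ and $w\ne0$ are real, then $$\frac{\prod_{n\ge1}\bigl(1-e^{-\frac{2\pi}{x_2}\sqrt{n^2x_1^2+w^2}}\bigr)}{\prod_{n\ge1}\bigl(1-e^{-\frac{2\pi}{x_1}\sqrt{n^2x_2^2+w^2}}\bigr)}=\Bigl(\frac{x_1}{x_2}\Bigr)^{\frac{\pi w^2}{2x_1x_2}}\sqrt{\frac{\sinh(\pi w/x_1)}{\sinh(\pi w/x_2)}}\;e^{\frac{\pi}{12}\left(\frac{x_1}{x_2}-\frac{x_2}{x_1}\right)+\pi\sum_{n\ge1}\left\{\frac{\sqrt{x_2^2n^2+w^2}}{x_1}-\frac{\sqrt{x_1^2n^2+w^2}}{x_2}-\frac{x_2n}{x_1}+\frac{x_1n}{x_2}\right\}}$$ with nonnegative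 square roots. For $w=0$ (and $x_1,x_2$ complex as above, with $s_n=nx_1$, $r_n=nx_2$) the formula reads $$\frac{\prod_{n\ge1}\bigl(1-e^{-2\pi nx_1/x_2}\bigr)}{\prod_{n\ge1}\bigl(1-e^{-2\pi nx_2/x_1}\bigr)}=\sqrt{\frac{x_2}{x_1}}\;e^{\frac{\pi}{12}\left(\frac{x_1}{x_2}-\frac{x_2}{x_1}\right)},$$ which is the transformation formula $\eta(-1/\tau)=\sqrt{-i\tau}\,\eta(\tau)$, $\operatorname{Im}\tau>0$ (with $\tau=ix_2/x_1$, principal square roots), for $\eta(\tau)=e^{\pi i\tau/12}\prod_{n\ge1}(1-e^{2\pi in\tau})$. -/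

import Mathlib

/-- The principal square root of a complex number (`√0 = 0`, otherwise the argument of the
root lies in `(-π/2, π/2]`). -/
noncomputable def csqrt (z : ℂ) : ℂ := z ^ (1 / 2 : ℂ)

/-- `s n` is a choice of `√(n² x² + w²)` for every `n ≥ 1`, and it is the principal value for all
but finitely many `n`. The sequence consisting of the principal values is one such choice; the
values continued in `w` from `s n = n x` at `w = 0` are another. -/
def IsRootSeq (x w : ℂ) (s : ℕ+ → ℂ) : Prop :=
  (∀ n : ℕ+, s n ^ 2 = (n : ℂ) ^ 2 * x ^ 2 + w ^ 2) ∧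
    ∀ᶠ n : ℕ+ in Filter.cofinite, s n = csqrt ((n : ℂ) ^ 2 * x ^ 2 + w ^ 2)

/-- `sinh(π w / x₁) / sinh(π w / x₂)`, with its limiting value `x₂ / x₁` at `w = 0`. -/
noncomputable def sinhRatio (x₁ x₂ w : ℂ) : ℂ :=
  if w = 0 then x₂ / x₁ else Complex.sinh (Real.pi * w / x₁) / Complex.sinh (Real.pi * w / x₂)

/-- The factor `1 - exp (-(2π / y) s_n)` of the infinite products. -/
noncomputable def etaFactor (y : ℂ) (s : ℕ+ → ℂ) (n : ℕ+) : ℂ :=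
  1 - Complex.exp (-(2 * Real.pi / y) * s n)

/-- The `n`-th term of the series of square-root differences. -/
noncomputable def rootDiff (x₁ x₂ : ℂ) (s r : ℕ+ → ℂ) (n : ℕ+) : ℂ :=
  r n / x₁ - s n / x₂ - x₂ * n / x₁ + x₁ * n / x₂

/-- The factor `(s_n / (n x₁)) / (r_n / (n x₂))`, which tends to `1`. -/
noncomputable def rootFactor (x₁ x₂ : ℂ) (s r : ℕ+ → ℂ) (n : ℕ+) : ℂ :=
  (s n / (n * x₁)) / (r n / (n * x₂))

/-- The value of `√(sinh(π w / x₁) / sinh(π w / x₂))` that goes with the choice `s`, `r` of the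
roots `√(n² x₁² + w²)`, `√(n² x₂² + w²)`. For the values continued from `w = 0`, it is the
continuation of the square root from its principal value `√(x₂ / x₁)` at `w = 0`. -/
noncomputable def sinhRatioRoot (x₁ x₂ : ℂ) (s r : ℕ+ → ℂ) : ℂ :=
  csqrt (x₂ / x₁) * ∏' n : ℕ+, rootFactor x₁ x₂ s r n

open Filter Topology

/-! Put t = x₁/x₂. Since 1 - e^(-2πz) = 2πz e^(-πz) `sinhc z`, and Euler's product expands `sinhc (s
n / x₂)` over k into the numbers n²x₁² + k²x₂² + w² (suitably normalised), numerator and denominator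
are built from the same double array, multiplied by rows in one and by columns in the other. With
convergence factors of genus 1 the double product converges absolutely
(`multipliable_canonicalFactor`), so the two arrangements have the same nonzero value and cancel in
the quotient.

What survives is the quotient at w = 0, the factors s_n/(n x₁) and r_n/(n x₂), the series of root
differences, and the convergence factors. The exponents of the latter are row and column sums of
w²/(n²x₁² + k²x₂²), a double series that is not absolutely summable, so the order matters: the
normalised row sums minus column sums add up to (π/2) log t (`hasSum_rowSum_sub`). This produces the
power of x₁/x₂.

Both that discrepancy and the quotient at w = 0 come from the logarithm of the eta transformation
(`logEulerProd_sub`). Partial fractions of the cotangent write a row sum through ∑ₘ e^(-2πmnt)/n,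
and summing this over n gives `-logEulerProd t`.

No branch has to be followed in w: the double product sees only s_n², and the remaining factors
change consistently with the sign of s_n. The principal choice matters only for convergence. -/

/-! ### The Euler product and its logarithm -/

lemma summable_pnat_geometric {ρ : ℝ} (h0 : 0 ≤ ρ) (h1 : ρ < 1) :
    Summable fun n : ℕ+ ↦ ρ ^ (n : ℕ) :=
  (summable_geometric_of_lt_one h0 h1).comp_injective PNat.coe_injective

lemma norm_exp_neg_two_pi_mul (n : ℕ+) (t : ℂ) :
    ‖Complex.exp (-(2 * Real.pi * n * t))‖ = Real.exp (-(2 * Real.pi * t.re)) ^ (n : ℕ) := by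
  rw [Complex.norm_exp, ← Real.exp_nat_mul]
  congr 1
  have : (2 * Real.pi * n * t : ℂ) = ((2 * Real.pi * n : ℝ) : ℂ) * t := by push_cast; ring
  rw [Complex.neg_re, this, Complex.re_ofReal_mul]
  ring

lemma exp_neg_two_pi_mul_lt_one {x : ℝ} (hx : 0 < x) : Real.exp (-(2 * Real.pi * x)) < 1 := by
  rw [Real.exp_lt_one_iff]
  have := Real.pi_pos
  nlinarith [mul_pos this hx]

lemma norm_exp_neg_two_pi_mul_lt_one (n : ℕ+) {t : ℂ} (ht : 0 < t.re) :
    ‖Complex.exp (-(2 * Real.pi * n * t))‖ < 1 := by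
  rw [norm_exp_neg_two_pi_mul]
  exact pow_lt_one₀ (Real.exp_pos _).le (exp_neg_two_pi_mul_lt_one ht) n.ne_zero

lemma summable_exp_neg_two_pi_mul {t : ℂ} (ht : 0 < t.re) :
    Summable fun n : ℕ+ ↦ Complex.exp (-(2 * Real.pi * n * t)) := by
  apply Summable.of_norm
  simp_rw [norm_exp_neg_two_pi_mul]
  exact summable_pnat_geometric (Real.exp_pos _).le (exp_neg_two_pi_mul_lt_one ht)

lemma one_sub_exp_neg_two_pi_mul_ne_zero (n : ℕ+) {t : ℂ} (ht : 0 < t.re) :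
    1 - Complex.exp (-(2 * Real.pi * n * t)) ≠ 0 := by
  intro h
  have := norm_exp_neg_two_pi_mul_lt_one n ht
  rw [← sub_eq_zero.mp h] at this
  simp at this

lemma re_inv_pos {t : ℂ} (ht : 0 < t.re) : 0 < (t⁻¹).re := by
  rw [Complex.inv_re]
  have : t ≠ 0 := by rintro rfl; simp at ht
  exact div_pos ht (Complex.normSq_pos.mpr this)

lemma arg_ne_pi_of_re_pos {t : ℂ} (ht : 0 < t.re) : t.arg ≠ Real.pi := by
  intro h
  have := (Complex.abs_arg_lt_pi_div_two_iff.mpr (Or.inl ht))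
  rw [h, abs_of_pos Real.pi_pos] at this
  linarith [Real.pi_pos]

/-- The logarithm `∑ log (1 - exp (-2πnt))` of the Euler product. -/
noncomputable def logEulerProd (t : ℂ) : ℂ :=
  ∑' n : ℕ+, Complex.log (1 - Complex.exp (-(2 * Real.pi * n * t)))

lemma summable_log_one_sub_exp {t : ℂ} (ht : 0 < t.re) :
    Summable fun n : ℕ+ ↦ Complex.log (1 - Complex.exp (-(2 * Real.pi * n * t))) := by
  simpa [sub_eq_add_neg] using
    Complex.summable_log_one_add_of_summable (summable_exp_neg_two_pi_mul ht).neg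

lemma hasProd_one_sub_exp {t : ℂ} (ht : 0 < t.re) :
    HasProd (fun n : ℕ+ ↦ 1 - Complex.exp (-(2 * Real.pi * n * t)))
      (Complex.exp (logEulerProd t)) :=
  Complex.hasProd_of_hasSum_log (fun n ↦ one_sub_exp_neg_two_pi_mul_ne_zero n ht)
    (summable_log_one_sub_exp ht).hasSum

lemma continuousOn_logEulerProd : ContinuousOn logEulerProd {t : ℂ | 0 < t.re} := by
  have key : ∀ ε > 0, ContinuousOn logEulerProd {t : ℂ | ε < t.re} := by
    intro ε hε
    set ρ := Real.exp (-(2 * Real.pi * ε)) with hρ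
    have hρ1 : ρ < 1 := exp_neg_two_pi_mul_lt_one hε
    have hρ0 : 0 < ρ := Real.exp_pos _
    -- The majorant comes from |log(1+z)| ≤ |z|²(1-|z|)⁻¹/2 + |z| with |z| ≤ ρⁿ ≤ ρ.
    apply continuousOn_tsum
      (u := fun n : ℕ+ ↦ ρ ^ (n : ℕ) * ((1 - ρ)⁻¹ / 2 + 1))
    · intro n t ht
      apply ContinuousAt.continuousWithinAt
      apply ContinuousAt.clog (by fun_prop)
      left
      have h := norm_exp_neg_two_pi_mul_lt_one n (hε.trans ht)
      have := (Complex.re_le_norm _).trans_lt h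
      simp only [Complex.sub_re, Complex.one_re]
      linarith
    · exact (summable_pnat_geometric hρ0.le hρ1).mul_right _
    · intro n t ht
      have ht0 : 0 < t.re := hε.trans ht
      have h1 : ‖-Complex.exp (-(2 * Real.pi * n * t))‖ ≤ ρ ^ (n : ℕ) := by
        rw [norm_neg, norm_exp_neg_two_pi_mul]
        apply pow_le_pow_left₀ (Real.exp_pos _).le
        apply Real.exp_le_exp.mpr
        have : ε < t.re := ht
        have := mul_lt_mul_of_pos_left this Real.pi_pos
        linarith
      have h2 : ρ ^ (n : ℕ) ≤ ρ := pow_le_of_le_one hρ0.le hρ1.le n.ne_zero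
      have h3 := Complex.norm_log_one_add_le
        (z := -Complex.exp (-(2 * Real.pi * n * t))) (by linarith)
      rw [← sub_eq_add_neg] at h3
      refine h3.trans ?_
      have hy0 := norm_nonneg (-Complex.exp (-(2 * Real.pi * n * t)))
      generalize ‖-Complex.exp (-(2 * Real.pi * n * t))‖ = y at *
      have h4 : y ^ 2 ≤ ρ ^ (n : ℕ) := by nlinarith
      have h5 : (1 - y)⁻¹ ≤ (1 - ρ)⁻¹ := inv_anti₀ (by linarith) (by linarith)
      have h6 : 0 < (1 - y)⁻¹ := inv_pos.mpr (by linarith)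
      have := mul_le_mul h4 h5 h6.le (by positivity)
      linarith
  intro t ht
  have ht' : 0 < t.re := ht
  have h := key (t.re / 2) (by positivity)
  have ho : IsOpen {s : ℂ | t.re / 2 < s.re} := isOpen_lt continuous_const Complex.continuous_re
  exact (h.continuousAt (ho.mem_nhds (by simp [ht']))).continuousWithinAt

/-! ### The eta transformation and its logarithm -/

theorem eta_neg_one_div (τ : ℂ) (hτ : 0 < τ.im) :
    ModularForm.eta (-1 / τ) = csqrt (-Complex.I * τ) * ModularForm.eta τ := by
  have h := ModularForm.eta_comp_eq_csqrt_I_inv (x := τ) hτ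
  simp only [Function.comp_apply, Pi.smul_apply, Pi.mul_apply, smul_eq_mul] at h
  rw [h, ← mul_assoc]
  congr 1
  have hτ0 : τ ≠ 0 := by rintro rfl; simp at hτ
  -- Positivity of the argument keeps log τ - iπ/2 in the principal strip, so the two separate roots
  -- merge into one principal root of -iτ.
  have harg : 0 < τ.arg := by
    apply lt_of_le_of_ne (Complex.arg_nonneg_iff.mpr hτ.le)
    intro h0
    have := Complex.arg_eq_zero_iff.mp h0.symm
    linarith [this.2]
  have hlog : Complex.log (-Complex.I * τ) = -(Real.pi / 2 * Complex.I) + Complex.log τ := by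
    rw [Complex.log_mul (by simp) hτ0, Complex.log_neg_I]
    · ring
    · rw [Complex.arg_neg_I]
      constructor
      · linarith [Real.pi_pos]
      · linarith [Complex.arg_le_pi τ, Real.pi_pos]
  rw [csqrt, Complex.sqrt, Complex.sqrt, Complex.cpow_def_of_ne_zero Complex.I_ne_zero,
    Complex.cpow_def_of_ne_zero hτ0,
    Complex.cpow_def_of_ne_zero (mul_ne_zero (by simp) hτ0), hlog, Complex.log_I, ← Complex.exp_neg,
    ← Complex.exp_add]
  congr 1
  ring

lemma eta_I_mul {t : ℂ} (ht : 0 < t.re) :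
    ModularForm.eta (Complex.I * t) =
      Complex.exp (-(Real.pi * t / 12)) * Complex.exp (logEulerProd t) := by
  rw [ModularForm.eta, ← (hasProd_one_sub_exp ht).tprod_eq]
  congr 1
  · rw [Function.Periodic.qParam]
    congr 1
    push_cast
    linear_combination (Real.pi * t / 12) * Complex.I_sq
  · rw [tprod_pnat_eq_tprod_succ (f := fun n : ℕ ↦ 1 - Complex.exp (-(2 * Real.pi * n * t)))]
    refine tprod_congr fun n ↦ ?_
    rw [ModularForm.eta_q_eq_cexp]
    congr 2
    push_cast
    linear_combination (2 * Real.pi * (n + 1) * t) * Complex.I_sq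

lemma exp_logEulerProd_div {t : ℂ} (ht : 0 < t.re) :
    Complex.exp (logEulerProd t - logEulerProd t⁻¹) =
      Complex.exp (-(Complex.log t / 2) + Real.pi / 12 * (t - t⁻¹)) := by
  have ht0 : t ≠ 0 := by rintro rfl; simp at ht
  have hi := re_inv_pos ht
  have h := eta_neg_one_div (Complex.I * t⁻¹) (by simpa using hi)
  have e1 : -1 / (Complex.I * t⁻¹) = Complex.I * t := by
    field_simp
    simp
  have e2 : -Complex.I * (Complex.I * t⁻¹) = t⁻¹ := by
    linear_combination -t⁻¹ * Complex.I_sq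
  rw [e1, e2, eta_I_mul ht, eta_I_mul hi, csqrt, Complex.cpow_def_of_ne_zero (inv_ne_zero ht0),
    Complex.log_inv _ (arg_ne_pi_of_re_pos ht), ← Complex.exp_add, ← Complex.exp_add,
    ← Complex.exp_add] at h
  have := congrArg (· * Complex.exp (Real.pi * t / 12 - logEulerProd t⁻¹)) h
  simp only [← Complex.exp_add] at this
  convert this using 2 <;> ring

/-- Both sides are continuous on the connected right half-plane, have the same exponential and
vanish at t = 1; uniqueness of lifts through the covering `exp` removes the ambiguity 2πiℤ. -/
theorem logEulerProd_sub {t : ℂ} (ht : 0 < t.re) :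
    logEulerProd t - logEulerProd t⁻¹ = -(Complex.log t / 2) + Real.pi / 12 * (t - t⁻¹) := by
  have hne : ∀ s ∈ {s : ℂ | 0 < s.re}, s ≠ 0 := by rintro s hs rfl; simp at hs
  refine Complex.isCoveringMap_exp.eqOn_of_comp_eqOn (s := {s : ℂ | 0 < s.re})
    (g₁ := fun t ↦ logEulerProd t - logEulerProd t⁻¹)
    (g₂ := fun t ↦ -(Complex.log t / 2) + Real.pi / 12 * (t - t⁻¹)) (a := 1)
    (convex_halfSpace_re_gt 0).isPreconnected ?_ ?_ ?_ (by simp) (by simp) ht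
  · exact continuousOn_logEulerProd.sub (continuousOn_logEulerProd.comp
      (continuousOn_inv₀.mono hne) fun s hs ↦ re_inv_pos hs)
  · refine ContinuousOn.add (ContinuousOn.neg (ContinuousOn.div_const
      (continuousOn_id.clog fun s hs ↦ Or.inl hs) _)) (ContinuousOn.mul continuousOn_const
      (continuousOn_id.sub (continuousOn_inv₀.mono hne)))
  · exact fun s hs ↦ Subtype.ext (exp_logEulerProd_div hs)

/-! ### Row and column sums of the conditionally convergent double series -/

lemma summable_pnat_one_div_sq : Summable fun n : ℕ+ ↦ 1 / (n : ℝ) ^ 2 :=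
  ((Real.summable_one_div_nat_pow (p := 2)).mpr one_lt_two).comp_injective PNat.coe_injective

lemma hasSum_pnat_one_div_sq : HasSum (fun n : ℕ+ ↦ 1 / (n : ℂ) ^ 2) ((Real.pi : ℂ) ^ 2 / 6) := by
  have h := Complex.hasSum_ofReal.mpr hasSum_zeta_two
  push_cast at h
  refine (PNat.coe_injective.hasSum_iff (f := fun n : ℕ ↦ 1 / (n : ℂ) ^ 2) fun n hn ↦ ?_).mpr h
  have : n = 0 := by
    by_contra h0
    exact hn ⟨⟨n, Nat.pos_of_ne_zero h0⟩, rfl⟩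
  simp [this]

/-- `|n² t² + k²| ≥ 2 n k Re t` in the right half-plane. -/
lemma two_mul_mul_re_le_norm {t : ℂ} (ht : 0 < t.re) {n k : ℝ} (hn : 0 < n) (hk : 0 < k) :
    2 * n * k * t.re ≤ ‖(n : ℂ) ^ 2 * t ^ 2 + (k : ℂ) ^ 2‖ := by
  have h1 : ‖(n : ℂ) ^ 2 * t ^ 2 + (k : ℂ) ^ 2‖ ^ 2 =
      (n ^ 2 * (t.re ^ 2 - t.im ^ 2) + k ^ 2) ^ 2 + (n ^ 2 * (2 * t.re * t.im)) ^ 2 := by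
    rw [Complex.sq_norm, Complex.normSq_apply]
    simp [pow_two]
    ring
  rw [← pow_le_pow_iff_left₀ (by positivity) (norm_nonneg _) two_ne_zero, h1]
  -- The difference of the two squares is exactly (n²|t|² - k²)².
  nlinarith [sq_nonneg (n ^ 2 * (t.re ^ 2 + t.im ^ 2) - k ^ 2)]

lemma sq_mul_sq_add_sq_ne_zero {t : ℂ} (ht : 0 < t.re) (n k : ℕ+) :
    (n : ℂ) ^ 2 * t ^ 2 + (k : ℂ) ^ 2 ≠ 0 := by
  have h := two_mul_mul_re_le_norm ht (n := n) (k := k) (by exact_mod_cast n.pos)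
    (by exact_mod_cast k.pos)
  have hn : (0 : ℝ) < n := by exact_mod_cast n.pos
  have hk : (0 : ℝ) < k := by exact_mod_cast k.pos
  push_cast at h
  rw [← norm_pos_iff]
  exact lt_of_lt_of_le (by positivity) h

/-- Compare the partial fractions of π cot(πz) with its q-expansion at z = ia. -/
lemma hasSum_inv_sq_add_sq {a : ℂ} (ha : 0 < a.re) :
    HasSum (fun k : ℕ+ ↦ a / (a ^ 2 + (k : ℂ) ^ 2))
      (Real.pi / 2 + Real.pi * ∑' m : ℕ+, Complex.exp (-(2 * Real.pi * m * a)) -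
        1 / (2 * a)) := by
  have ha0 : a ≠ 0 := by rintro rfl; simp at ha
  have hne (k : ℕ+) : a ^ 2 + (k : ℂ) ^ 2 ≠ 0 := by
    simpa using sq_mul_sq_add_sq_ne_zero ha 1 k
  set z : UpperHalfPlane := ⟨Complex.I * a, by simpa using ha⟩ with hz
  have h1 := cot_series_rep (UpperHalfPlane.coe_mem_integerComplement z)
  rw [pi_mul_cot_pi_q_exp] at h1
  have hzc : (z : ℂ) = Complex.I * a := rfl
  rw [hzc] at h1
  have hterm (n : ℕ+) : 1 / (Complex.I * a - n) + 1 / (Complex.I * a + n) =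
      (-2 * Complex.I) * (a / (a ^ 2 + (n : ℂ) ^ 2)) := by
    have e : (Complex.I * a - n) * (Complex.I * a + n) = -(a ^ 2 + (n : ℂ) ^ 2) := by
      linear_combination a ^ 2 * Complex.I_sq
    have e0 : (Complex.I * a - n) * (Complex.I * a + n) ≠ 0 := by
      rw [e]; exact neg_ne_zero.mpr (hne n)
    rw [div_add_div _ _ (left_ne_zero_of_mul e0) (right_ne_zero_of_mul e0), e]
    have := hne n
    field_simp
    ring
  have hsum : Summable fun k : ℕ+ ↦ a / (a ^ 2 + (k : ℂ) ^ 2) := by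
    have h := summable_cotTerm (UpperHalfPlane.coe_mem_integerComplement z)
    have h' := (summable_pnat_iff_summable_succ
      (f := fun n : ℕ ↦ 1 / (Complex.I * a - n) + 1 / (Complex.I * a + n))).mpr (by
        simpa [cotTerm, hzc] using h)
    simp_rw [hterm] at h'
    exact (summable_mul_left_iff (by simp)).mp h'
  have h3 : ∑' n : ℕ, Complex.exp (2 * Real.pi * Complex.I * (Complex.I * a)) ^ n =
      1 + ∑' m : ℕ+, Complex.exp (-(2 * Real.pi * m * a)) := by
    have e : Complex.exp (2 * Real.pi * Complex.I * (Complex.I * a)) =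
        Complex.exp (-(2 * Real.pi * a)) := by
      congr 1
      linear_combination 2 * Real.pi * a * Complex.I_sq
    have hlt : ‖Complex.exp (-(2 * Real.pi * a))‖ < 1 := by
      simpa using norm_exp_neg_two_pi_mul_lt_one 1 ha
    rw [e, (summable_geometric_of_norm_lt_one hlt).tsum_eq_zero_add, pow_zero,
      ← tsum_pnat_eq_tsum_succ (f := fun n ↦ Complex.exp (-(2 * Real.pi * a)) ^ n)]
    congr 1
    refine tsum_congr fun m ↦ ?_
    rw [← Complex.exp_nat_mul]
    congr 1
    ring
  simp_rw [hterm] at h1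
  rw [h3, tsum_mul_left] at h1
  convert hsum.hasSum using 1
  have e1 : 1 / (Complex.I * a) = -Complex.I / a := by
    field_simp; simp
  rw [e1] at h1
  generalize ∑' m : ℕ+, Complex.exp (-(2 * Real.pi * m * a)) = A at h1 ⊢
  generalize ∑' k : ℕ+, a / (a ^ 2 + (k : ℂ) ^ 2) = B at h1 ⊢
  field_simp at h1 ⊢
  linear_combination (-1) * h1

/-- The sum over `k ≥ 1` of `t / (n² t² + k²)`. -/
noncomputable def rowSum (t : ℂ) (n : ℕ+) : ℂ :=
  Real.pi / 2 * (1 / n) + Real.pi * ∑' m : ℕ+, Complex.exp (-(2 * Real.pi * m * (n * t))) / n -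
    t⁻¹ / 2 * (1 / (n : ℂ) ^ 2)

lemma pnat_mul_re_pos (n : ℕ+) {t : ℂ} (ht : 0 < t.re) : 0 < ((n : ℂ) * t).re := by
  have hn : (0 : ℝ) < n := by exact_mod_cast n.pos
  have : ((n : ℂ) * t).re = n * t.re := by simp
  rw [this]
  positivity

lemma hasSum_rowSum {t : ℂ} (ht : 0 < t.re) (n : ℕ+) :
    HasSum (fun k : ℕ+ ↦ t / ((n : ℂ) ^ 2 * t ^ 2 + (k : ℂ) ^ 2)) (rowSum t n) := by
  have ht0 : t ≠ 0 := by rintro rfl; simp at ht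
  have hn : (n : ℂ) ≠ 0 := by exact_mod_cast n.ne_zero
  have h := (hasSum_inv_sq_add_sq (pnat_mul_re_pos n ht)).mul_left (1 / (n : ℂ))
  convert! h using 1
  · funext k
    rw [mul_pow]
    field_simp
  · rw [rowSum, tsum_div_const]
    generalize ∑' m : ℕ+, Complex.exp (-(2 * Real.pi * m * (n * t))) = A
    field_simp

/-- The double series is absolutely summable, dominated by ρ^(mn). Summed over n first, it is the
Taylor series of -log(1 - e^(-2πmt)). -/
lemma hasSum_tsum_exp_div {t : ℂ} (ht : 0 < t.re) :
    HasSum (fun n : ℕ+ ↦ ∑' m : ℕ+, Complex.exp (-(2 * Real.pi * m * (n * t))) / n)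
      (-logEulerProd t) := by
  set F : ℕ+ × ℕ+ → ℂ := fun p ↦ Complex.exp (-(2 * Real.pi * p.1 * (p.2 * t))) / p.2 with hF
  have hρ : ‖Real.exp (-(2 * Real.pi * t.re))‖ < 1 := by
    rw [Real.norm_of_nonneg (Real.exp_pos _).le]
    exact exp_neg_two_pi_mul_lt_one ht
  have hS : Summable F := by
    refine Summable.of_norm_bounded (by simpa using summable_prod_mul_pow 0 hρ) fun p ↦ ?_
    have h1 : (1 : ℝ) ≤ (p.2 : ℕ) := by exact_mod_cast p.2.pos
    rw [hF, norm_div, norm_exp_neg_two_pi_mul, Complex.norm_natCast]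
    refine (div_le_self (by positivity) h1).trans_eq ?_
    have : ((p.2 : ℂ) * t).re = p.2 * t.re := by simp
    rw [this, ← Real.exp_nat_mul, ← Real.exp_nat_mul]
    congr 1
    push_cast
    ring
  have hfib (m : ℕ+) : HasSum (fun n : ℕ+ ↦ F (m, n))
      (-Complex.log (1 - Complex.exp (-(2 * Real.pi * m * t)))) := by
    have h := Complex.hasSum_taylorSeries_neg_log (norm_exp_neg_two_pi_mul_lt_one m ht)
    have h' := (PNat.coe_injective.hasSum_iff fun n hn ↦ ?_).mpr h
    · refine h'.congr_fun fun n ↦ ?_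
      simp only [hF, Function.comp_apply, ← Complex.exp_nat_mul]
      congr 2
      ring
    · have : n = 0 := by
        by_contra h0
        exact hn ⟨⟨n, Nat.pos_of_ne_zero h0⟩, rfl⟩
      simp [this]
  have e : ∑' p, F p = -logEulerProd t := by
    rw [logEulerProd, ← tsum_neg]
    exact (hS.hasSum.prod_fiberwise hfib).tsum_eq.symm
  rw [← e]
  have hs := (Equiv.prodComm ℕ+ ℕ+).hasSum_iff.mpr hS.hasSum
  exact hs.prod_fiberwise fun n ↦ (hs.summable.prod_factor n).hasSum

/-- Since t⁻¹/(n²t⁻² + k²) = t/(k²t² + n²), `rowSum t⁻¹` is a column sum of the same array. The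
harmonic terms π/(2n) cancel, and the ζ(2) terms cancel the rational part of `logEulerProd_sub`. -/
theorem hasSum_rowSum_sub {t : ℂ} (ht : 0 < t.re) :
    HasSum (fun n : ℕ+ ↦ rowSum t n - rowSum t⁻¹ n) (Real.pi / 2 * Complex.log t) := by
  have h := (((hasSum_tsum_exp_div ht).sub (hasSum_tsum_exp_div (re_inv_pos ht))).mul_left
    (Real.pi : ℂ)).sub (hasSum_pnat_one_div_sq.mul_left ((t⁻¹ - t) / 2))
  convert! h using 1
  · funext n
    simp only [rowSum, inv_inv]
    ring
  · linear_combination Real.pi * logEulerProd_sub ht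

/-! ### The absolutely convergent double product -/

/-- The numbers `n² x² + k² y²`. -/
noncomputable def latticeForm (x y : ℂ) (p : ℕ+ × ℕ+) : ℂ :=
  (p.1 : ℂ) ^ 2 * x ^ 2 + (p.2 : ℂ) ^ 2 * y ^ 2

lemma latticeForm_swap (x y : ℂ) (n k : ℕ+) :
    latticeForm x y (n, k) = latticeForm y x (k, n) := by
  simp only [latticeForm]; ring

lemma latticeForm_eq {x y : ℂ} (hy : y ≠ 0) (p : ℕ+ × ℕ+) :
    latticeForm x y p = y ^ 2 * ((p.1 : ℂ) ^ 2 * (x / y) ^ 2 + (p.2 : ℂ) ^ 2) := by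
  simp only [latticeForm]
  field_simp

lemma latticeForm_ne_zero {x y : ℂ} (hy : y ≠ 0) (ht : 0 < (x / y).re) (p : ℕ+ × ℕ+) :
    latticeForm x y p ≠ 0 := by
  rw [latticeForm_eq hy]
  exact mul_ne_zero (pow_ne_zero _ hy) (sq_mul_sq_add_sq_ne_zero ht _ _)

/-- The lower bound 2nk Re(x/y) dominates the series by a multiple of ∑ 1/(n²k²); exponent 2 is what
genus 1 requires. -/
lemma summable_inv_latticeForm_sq {x y : ℂ} (hy : y ≠ 0) (ht : 0 < (x / y).re) :
    Summable fun p : ℕ+ × ℕ+ ↦ ‖(latticeForm x y p)⁻¹‖ ^ 2 := by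
  have hS := (summable_pnat_one_div_sq.mul_of_nonneg summable_pnat_one_div_sq
    (fun n ↦ by positivity) (fun n ↦ by positivity)).mul_left ((‖y‖ ^ 2 * (2 * (x / y).re)) ^ 2)⁻¹
  refine hS.of_nonneg_of_le (fun p ↦ by positivity) fun p ↦ ?_
  have hn : (0 : ℝ) < p.1 := by exact_mod_cast p.1.pos
  have hk : (0 : ℝ) < p.2 := by exact_mod_cast p.2.pos
  have h := two_mul_mul_re_le_norm ht hn hk
  have hy' : 0 < ‖y‖ := norm_pos_iff.mpr hy
  have e : ((‖y‖ ^ 2 * (2 * (x / y).re)) ^ 2)⁻¹ * (1 / (p.1 : ℝ) ^ 2 * (1 / (p.2 : ℝ) ^ 2)) =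
      ((‖y‖ ^ 2 * (2 * p.1 * p.2 * (x / y).re))⁻¹) ^ 2 := by
    field_simp
  rw [e, latticeForm_eq hy, norm_inv, norm_mul, norm_pow]
  push_cast at h
  gcongr

lemma norm_one_add_mul_exp_neg_sub_one_le {z : ℂ} (hz : ‖z‖ ≤ 1) :
    ‖(1 + z) * Complex.exp (-z) - 1‖ ≤ 3 * ‖z‖ ^ 2 := by
  have h := Complex.norm_exp_sub_one_sub_id_le (x := -z) (by simpa using hz)
  rw [norm_neg] at h
  have e : (1 + z) * Complex.exp (-z) - 1 = -z ^ 2 + (1 + z) * (Complex.exp (-z) - 1 - -z) := by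
    ring
  rw [e]
  have h2 : ‖1 + z‖ ≤ 2 := (norm_add_le _ _).trans (by rw [norm_one]; linarith)
  calc _ ≤ ‖z‖ ^ 2 + 2 * ‖z‖ ^ 2 := by
        refine (norm_add_le _ _).trans ?_
        rw [norm_neg, norm_pow, norm_mul]
        gcongr
    _ = _ := by ring

/-- The factors of the canonical product of genus `1` with zeros `-(n² x² + k² y²)`. -/
noncomputable def canonicalFactor (x y u : ℂ) (p : ℕ+ × ℕ+) : ℂ :=
  (1 + u / latticeForm x y p) * Complex.exp (-(u / latticeForm x y p))

lemma summable_canonicalFactor_sub_one {x y : ℂ} (hy : y ≠ 0) (ht : 0 < (x / y).re) (u : ℂ) :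
    Summable fun p ↦ ‖canonicalFactor x y u p - 1‖ := by
  have hS := summable_inv_latticeForm_sq hy ht
  have h0 : ∀ᶠ p in cofinite, ‖u / latticeForm x y p‖ ≤ 1 := by
    have h := (hS.mul_left (‖u‖ ^ 2)).tendsto_cofinite_zero.eventually_le_const one_pos
    filter_upwards [h] with p hp
    rw [← mul_pow, ← norm_mul, ← div_eq_mul_inv] at hp
    exact (sq_le_one_iff₀ (norm_nonneg _)).mp hp
  refine (hS.mul_left (3 * ‖u‖ ^ 2)).of_norm_bounded_eventually ?_
  filter_upwards [h0] with p hp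
  rw [norm_norm]
  refine (norm_one_add_mul_exp_neg_sub_one_le hp).trans_eq ?_
  rw [div_eq_mul_inv, norm_mul, mul_pow, mul_assoc]

lemma multipliable_canonicalFactor {x y : ℂ} (hy : y ≠ 0) (ht : 0 < (x / y).re) (u : ℂ) :
    Multipliable (canonicalFactor x y u) := by
  simpa using multipliable_one_add_of_summable (summable_canonicalFactor_sub_one hy ht u)

lemma tprod_canonicalFactor_ne_zero {x y u : ℂ} (hy : y ≠ 0) (ht : 0 < (x / y).re)
    (hu : ∀ p, latticeForm x y p + u ≠ 0) : ∏' p, canonicalFactor x y u p ≠ 0 := by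
  have := tprod_one_add_ne_zero_of_summable (f := fun p ↦ canonicalFactor x y u p - 1)
    (fun p ↦ ?_) (summable_canonicalFactor_sub_one hy ht u)
  · simpa using this
  · have h := latticeForm_ne_zero hy ht p
    rw [add_sub_cancel]
    refine mul_ne_zero ?_ (Complex.exp_ne_zero _)
    rw [one_add_div h]
    exact div_ne_zero (hu p) h

/-! ### Euler's product for sinh, and the product along a row -/

/-- The entire function `sinh (π z) / (π z)`. -/
noncomputable def sinhc (z : ℂ) : ℂ :=
  if z = 0 then 1 else Complex.sinh (Real.pi * z) / (Real.pi * z)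

lemma pi_mul_mul_sinhc (z : ℂ) : Real.pi * z * sinhc z = Complex.sinh (Real.pi * z) := by
  have := Real.pi_ne_zero
  by_cases h : z = 0
  · simp [h]
  · rw [sinhc, if_neg h]
    have : (Real.pi : ℂ) * z ≠ 0 := mul_ne_zero (by exact_mod_cast this) h
    field_simp

lemma sinhc_ne_zero {z : ℂ} (hz : ∀ k : ℕ+, z ^ 2 + (k : ℂ) ^ 2 ≠ 0) : sinhc z ≠ 0 := by
  have hpi : (Real.pi : ℂ) ≠ 0 := by exact_mod_cast Real.pi_ne_zero
  by_cases h : z = 0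
  · simp [sinhc, h]
  rw [sinhc, if_neg h]
  refine div_ne_zero (fun h0 ↦ ?_) (mul_ne_zero hpi h)
  rw [← mul_eq_zero_iff_right Complex.I_ne_zero, ← Complex.sin_mul_I] at h0
  obtain ⟨k, hk⟩ := Complex.sin_eq_zero_iff.mp h0
  have hk' : z * Complex.I = k := by
    apply mul_left_cancel₀ hpi
    linear_combination hk
  have hk0 : k ≠ 0 := by
    rintro rfl
    simp [h] at hk'
  have hsq : z ^ 2 + (k : ℂ) ^ 2 = 0 := by
    rw [← hk', mul_pow, Complex.I_sq]; ring
  refine hz ⟨k.natAbs, Int.natAbs_pos.mpr hk0⟩ ?_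
  rw [← hsq]
  congr 1
  rw [PNat.mk_coe, Nat.cast_natAbs]
  exact_mod_cast congrArg (Int.cast (R := ℂ)) (sq_abs k)

lemma hasProd_sinhc (z : ℂ) : HasProd (fun k : ℕ+ ↦ 1 + (z / k) ^ 2) (sinhc z) := by
  have hpi : (Real.pi : ℂ) ≠ 0 := by exact_mod_cast Real.pi_ne_zero
  by_cases h : z = 0
  · simp [sinhc, h]
  have hm := multipliable_sineTerm (z * Complex.I)
  have e (n : ℕ) : 1 + sineTerm (z * Complex.I) n = 1 + (z / ((n + 1 : ℕ) : ℂ)) ^ 2 := by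
    rw [sineTerm, mul_pow, Complex.I_sq, div_pow]
    push_cast
    ring
  have ht := tendsto_euler_sin_prod' (x := z * Complex.I) (by simp [h])
  have hP : HasProd (fun n : ℕ ↦ 1 + sineTerm (z * Complex.I) n) (sinhc z) := by
    refine (hm.hasProd_iff_tendsto_nat).mpr ?_
    convert! ht using 2
    rw [sinhc, if_neg h, ← mul_assoc, Complex.sin_mul_I]
    field_simp
  simp_rw [e] at hP
  exact (Equiv.pnatEquivNat.symm.hasProd_iff (f := fun k : ℕ+ ↦ 1 + (z / k) ^ 2)).mp hP

lemma ne_zero_of_re_pos {x : ℂ} (hx : 0 < x.re) : x ≠ 0 := by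
  rintro rfl; simp at hx

/-- Along a row, 1 + u/L, with L the lattice form, is the quotient of the Euler factors of `sinhc`
at s/y and nx/y, while the convergence factors add up to a row sum. -/
lemma hasProd_canonicalFactor_row {x y u s : ℂ} (hx : x ≠ 0) (hy : y ≠ 0) (ht : 0 < (x / y).re)
    (n : ℕ+) (hs : s ^ 2 = (n : ℂ) ^ 2 * x ^ 2 + u) :
    HasProd (fun k ↦ canonicalFactor x y u (n, k))
      (sinhc (s / y) / sinhc (n * x / y) *
        Complex.exp (-(u / (x * y) * rowSum (x / y) n))) := by
  have hne (k : ℕ+) : (n : ℂ) ^ 2 * (x / y) ^ 2 + (k : ℂ) ^ 2 ≠ 0 :=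
    sq_mul_sq_add_sq_ne_zero ht n k
  have h0 : sinhc (n * x / y) ≠ 0 := by
    apply sinhc_ne_zero
    intro k
    convert hne k using 2
    rw [mul_div_assoc, mul_pow]
  have h1 := (hasProd_sinhc (s / y)).div₀ (hasProd_sinhc (n * x / y)) h0
  have h2 := ((hasSum_rowSum ht n).mul_left (u / (x * y))).neg.cexp
  refine (h1.mul h2).congr_fun fun k ↦ ?_
  have hk : (k : ℂ) ≠ 0 := by exact_mod_cast k.ne_zero
  have hL := latticeForm_ne_zero hy ht (n, k)
  have hL' : latticeForm x y (n, k) = (n : ℂ) ^ 2 * x ^ 2 + (k : ℂ) ^ 2 * y ^ 2 := rfl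
  rw [canonicalFactor, Function.comp_apply]
  congr 1
  · have e1 : 1 + (s / y / k) ^ 2 = (latticeForm x y (n, k) + u) / (k ^ 2 * y ^ 2) := by
      rw [hL']
      field_simp
      linear_combination hs
    have e2 : 1 + (n * x / y / k) ^ 2 = latticeForm x y (n, k) / (k ^ 2 * y ^ 2) := by
      rw [hL']
      field_simp
      ring
    rw [e1, e2, div_div_div_cancel_right₀ (by positivity), add_div, div_self hL]
  · have e := latticeForm_eq (x := x) hy (n, k)
    have := hne k
    rw [e]
    congr 2
    field_simp

/-- Compares the factor with its value at w = 0, using 1 - e^(-2πz) = 2πz e^(-πz) `sinhc z` at z =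
s_n/y and z = nx/y. -/
lemma etaFactor_eq {x y : ℂ} {s : ℕ+ → ℂ} (hx : x ≠ 0) (hy : y ≠ 0) (ht : 0 < (x / y).re)
    (n : ℕ+) :
    etaFactor y s n = (1 - Complex.exp (-(2 * Real.pi * n * (x / y)))) * (s n / (n * x)) *
      Complex.exp (-(Real.pi * (s n / y - n * x / y))) * (sinhc (s n / y) / sinhc (n * x / y)) := by
  have hn : (n : ℂ) ≠ 0 := by exact_mod_cast n.ne_zero
  have hpi : (Real.pi : ℂ) ≠ 0 := by exact_mod_cast Real.pi_ne_zero
  have key (z : ℂ) : 1 - Complex.exp (-(2 * Real.pi * z)) =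
      2 * Complex.exp (-(Real.pi * z)) * (Real.pi * z * sinhc z) := by
    rw [pi_mul_mul_sinhc, Complex.sinh, show -(2 * Real.pi * z) = -(Real.pi * z) + -(Real.pi * z) by
      ring, Complex.exp_add]
    have : Complex.exp (-(Real.pi * z)) * Complex.exp (Real.pi * z) = 1 := by
      rw [← Complex.exp_add, neg_add_cancel, Complex.exp_zero]
    linear_combination -this
  have h0 : sinhc (n * x / y) ≠ 0 := by
    apply sinhc_ne_zero
    intro k
    convert sq_mul_sq_add_sq_ne_zero ht n k using 2
    rw [mul_div_assoc, mul_pow]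
  have e1 : etaFactor y s n = 1 - Complex.exp (-(2 * Real.pi * (s n / y))) := by
    rw [etaFactor]
    congr 3
    ring
  have e2 : -(2 * Real.pi * n * (x / y)) = -(2 * Real.pi * (n * x / y)) := by ring
  have e3 : Complex.exp (-(Real.pi * (s n / y))) = Complex.exp (-(Real.pi * (n * x / y))) *
      Complex.exp (-(Real.pi * (s n / y - n * x / y))) := by
    rw [← Complex.exp_add]
    congr 1
    ring
  rw [e1, e2, key, key, e3]
  field_simp

/-! ### Asymptotics of the roots -/

lemma csqrt_re_nonneg (z : ℂ) : 0 ≤ (csqrt z).re := by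
  by_cases h : z = 0
  · simp [csqrt, h]
  rw [csqrt, Complex.cpow_def_of_ne_zero h, Complex.exp_re]
  refine mul_nonneg (Real.exp_pos _).le (Real.cos_nonneg_of_mem_Icc ?_)
  have e : (Complex.log z * (1 / 2)).im = z.arg / 2 := by
    have : (1 / 2 : ℂ) = ((1 / 2 : ℝ) : ℂ) := by push_cast; ring
    rw [this, Complex.im_mul_ofReal, Complex.log_im]
    ring
  rw [e]
  constructor <;> linarith [Complex.neg_pi_lt_arg z, Complex.arg_le_pi z]

section asymptotics

variable {x w : ℂ} {s : ℕ+ → ℂ}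

lemma IsRootSeq.eventually_norm_add (hs : IsRootSeq x w s) :
    ∀ᶠ n : ℕ+ in cofinite, n * x.re ≤ ‖s n + n * x‖ := by
  filter_upwards [hs.2] with n hn
  refine le_trans ?_ (Complex.re_le_norm _)
  have h1 : (s n + n * x).re = (s n).re + n * x.re := by simp
  rw [h1, hn]
  linarith [csqrt_re_nonneg ((n : ℂ) ^ 2 * x ^ 2 + w ^ 2)]

/-- From (s_n - nx)(s_n + nx) = w², where the second factor is at least n Re x because principal
roots have nonnegative real part. -/
lemma IsRootSeq.eventually_norm_sub_le (hx : 0 < x.re) (hs : IsRootSeq x w s) :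
    ∀ᶠ n : ℕ+ in cofinite, ‖s n - n * x‖ ≤ ‖w‖ ^ 2 / x.re * (1 / n) := by
  filter_upwards [hs.eventually_norm_add] with n hn
  have hn0 : (0 : ℝ) < n := by exact_mod_cast n.pos
  have h1 : ‖s n - n * x‖ * ‖s n + n * x‖ = ‖w‖ ^ 2 := by
    rw [← norm_mul, ← norm_pow]
    congr 1
    linear_combination hs.1 n
  rw [div_mul_div_comm, mul_one, le_div_iff₀ (by positivity), ← h1]
  gcongr
  linarith

lemma IsRootSeq.summable_div_sub_one (hx : 0 < x.re) (hs : IsRootSeq x w s) :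
    Summable fun n ↦ ‖s n / (n * x) - 1‖ := by
  have hx0 := ne_zero_of_re_pos hx
  have hxn : 0 < ‖x‖ := norm_pos_iff.mpr hx0
  refine (summable_pnat_one_div_sq.mul_left
    (‖w‖ ^ 2 / x.re / ‖x‖)).of_norm_bounded_eventually ?_
  filter_upwards [hs.eventually_norm_sub_le hx] with n hn
  have hn0 : (0 : ℝ) < n := by exact_mod_cast n.pos
  have hn1 : (n : ℂ) ≠ 0 := by exact_mod_cast n.ne_zero
  rw [norm_norm, div_sub_one (mul_ne_zero hn1 hx0), norm_div, norm_mul, Complex.norm_natCast,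
    div_le_iff₀ (by positivity)]
  refine hn.trans_eq ?_
  field_simp

lemma IsRootSeq.summable_sub (hx : 0 < x.re) (hs : IsRootSeq x w s) :
    Summable fun n : ℕ+ ↦ s n - n * x - w ^ 2 / (2 * x) * (1 / n) := by
  have hx0 := ne_zero_of_re_pos hx
  have hxn : 0 < ‖x‖ := norm_pos_iff.mpr hx0
  refine (summable_pnat_one_div_sq.mul_left
    (‖w‖ ^ 2 * (‖w‖ ^ 2 / x.re) / (2 * ‖x‖ * x.re))).of_norm_bounded_eventually ?_
  filter_upwards [hs.eventually_norm_sub_le hx, hs.eventually_norm_add] with n hn hn'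
  have hn0 : (0 : ℝ) < n := by exact_mod_cast n.pos
  have hn1 : (n : ℂ) ≠ 0 := by exact_mod_cast n.ne_zero
  have hn2 : (1 : ℝ) ≤ n := by exact_mod_cast n.pos
  have hp : 0 < ‖s n + n * x‖ := lt_of_lt_of_le (by positivity) hn'
  have hp0 : s n + n * x ≠ 0 := norm_pos_iff.mp hp
  -- The right side is O(n⁻³); the cruder bound by a multiple of n⁻² suffices below.
  have e : s n - n * x - w ^ 2 / (2 * x) * (1 / n) =
      -(w ^ 2 * (s n - n * x)) / (2 * x * n * (s n + n * x)) := by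
    rw [eq_div_iff (by simp [hx0, hn1, hp0])]
    field_simp
    linear_combination (2 * x * n) * hs.1 n
  have e2 : ‖(2 : ℂ)‖ = 2 := by simp
  rw [e, norm_div, norm_neg, norm_mul, norm_mul, norm_mul, norm_mul, norm_pow,
    Complex.norm_natCast, e2]
  calc _ ≤ ‖w‖ ^ 2 * (‖w‖ ^ 2 / x.re * (1 / n)) / (2 * ‖x‖ * n * (n * x.re)) := by gcongr
    _ = ‖w‖ ^ 2 * (‖w‖ ^ 2 / x.re) / (2 * ‖x‖ * x.re) * (1 / (n : ℝ) ^ 2) * (1 / n) := by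
        field_simp
    _ ≤ _ := mul_le_of_le_one_right (by positivity) ((div_le_one hn0).mpr hn2)

lemma IsRootSeq.summable_exp (hx : 0 < x.re) (hs : IsRootSeq x w s) {y : ℂ}
    (hxy : 0 < (x / y).re) :
    Summable fun n ↦ ‖Complex.exp (-(2 * Real.pi / y) * s n)‖ := by
  have hy : y ≠ 0 := by rintro rfl; simp at hxy
  have hyn : 0 < ‖y‖ := norm_pos_iff.mpr hy
  set K := ‖w‖ ^ 2 / x.re / ‖y‖ with hK
  have hS := (summable_exp_neg_two_pi_mul hxy).norm.mul_left (Real.exp (2 * Real.pi * K))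
  refine hS.of_norm_bounded_eventually ?_
  filter_upwards [hs.eventually_norm_sub_le hx] with n hn
  have hn0 : (0 : ℝ) < n := by exact_mod_cast n.pos
  have hn2 : (1 : ℝ) ≤ n := by exact_mod_cast n.pos
  have h1 : ‖(s n - n * x) / y‖ ≤ K := by
    rw [norm_div, hK]
    gcongr
    exact hn.trans (mul_le_of_le_one_right (by positivity) ((div_le_one hn0).mpr hn2))
  have h2 := (Complex.re_le_norm _).trans (h1.trans' (norm_neg ((s n - n * x) / y)).le)
  have e : -(2 * Real.pi / y) * s n = ((2 * Real.pi : ℝ) : ℂ) * (-((s n - n * x) / y)) +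
      -(2 * Real.pi * n * (x / y)) := by
    push_cast
    field_simp
    ring
  rw [norm_norm, e, Complex.exp_add, norm_mul]
  gcongr
  rw [Complex.norm_exp, Complex.re_ofReal_mul]
  gcongr

end asymptotics

/-! ### The transformation formula -/

section transformation

variable {x₁ x₂ w : ℂ} {s r : ℕ+ → ℂ}

lemma IsRootSeq.multipliable_etaFactor (h₁ : 0 < x₁.re) (ht : 0 < (x₁ / x₂).re)
    (hs : IsRootSeq x₁ w s) : Multipliable (etaFactor x₂ s) := by
  have := multipliable_one_add_of_summable
    (f := fun n ↦ -Complex.exp (-(2 * Real.pi / x₂) * s n)) (by simpa using hs.summable_exp h₁ ht)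
  simp only [← sub_eq_add_neg] at this
  exact this

lemma IsRootSeq.etaFactor_ne_zero (h₂ : x₂ ≠ 0) (hs : IsRootSeq x₁ w s)
    (hw : ∀ n k : ℕ, 1 ≤ n → x₁ ^ 2 * (n : ℂ) ^ 2 + x₂ ^ 2 * (k : ℂ) ^ 2 ≠ -w ^ 2) (n : ℕ+) :
    etaFactor x₂ s n ≠ 0 := by
  have hpi : (Real.pi : ℂ) ≠ 0 := by exact_mod_cast Real.pi_ne_zero
  intro h
  rw [etaFactor, sub_eq_zero, eq_comm, Complex.exp_eq_one_iff] at h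
  obtain ⟨k, hk⟩ := h
  have hk' : s n = -(k * Complex.I * x₂) := by
    field_simp at hk
    linear_combination (-1) * hk
  have hsq := hs.1 n
  rw [hk'] at hsq
  refine hw n k.natAbs n.pos ?_
  have e : ((k.natAbs : ℕ) : ℂ) ^ 2 = (k : ℂ) ^ 2 := by
    rw [Nat.cast_natAbs]
    exact_mod_cast congrArg (Int.cast (R := ℂ)) (sq_abs k)
  rw [e]
  linear_combination k ^ 2 * x₂ ^ 2 * Complex.I_sq - hsq

lemma IsRootSeq.tprod_etaFactor_ne_zero (h₁ : 0 < x₁.re) (ht : 0 < (x₁ / x₂).re)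
    (hs : IsRootSeq x₁ w s)
    (hw : ∀ n k : ℕ, 1 ≤ n → x₁ ^ 2 * (n : ℂ) ^ 2 + x₂ ^ 2 * (k : ℂ) ^ 2 ≠ -w ^ 2) :
    ∏' n, etaFactor x₂ s n ≠ 0 := by
  have h₂ : x₂ ≠ 0 := by rintro rfl; simp at ht
  have hne := hs.etaFactor_ne_zero h₂ hw
  have := tprod_one_add_ne_zero_of_summable
    (f := fun n ↦ -Complex.exp (-(2 * Real.pi / x₂) * s n))
    (fun n ↦ by simpa [← sub_eq_add_neg, etaFactor] using hne n)
    (by simpa using hs.summable_exp h₁ ht)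
  simp only [← sub_eq_add_neg] at this
  exact this

lemma summable_rootDiff (h₁ : 0 < x₁.re) (h₂ : 0 < x₂.re) (hs : IsRootSeq x₁ w s)
    (hr : IsRootSeq x₂ w r) : Summable (rootDiff x₁ x₂ s r) := by
  have hx₁ := ne_zero_of_re_pos h₁
  have hx₂ := ne_zero_of_re_pos h₂
  -- The 1/n terms of the two expansions agree, both being w²/(2x₁x₂n), and cancel.
  refine (((hr.summable_sub h₂).div_const x₁).sub ((hs.summable_sub h₁).div_const x₂)).congr
    fun n ↦ ?_
  rw [rootDiff]
  field_simp
  ring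

lemma IsRootSeq.multipliable_div (h₁ : 0 < x₁.re) (hs : IsRootSeq x₁ w s) :
    Multipliable fun n : ℕ+ ↦ s n / (n * x₁) := by
  simpa using multipliable_one_add_of_summable (hs.summable_div_sub_one h₁)

lemma IsRootSeq.tprod_div_ne_zero (h₁ : 0 < x₁.re) (hs : IsRootSeq x₁ w s)
    (h0 : ∀ n, s n ≠ 0) : ∏' n : ℕ+, s n / (n * x₁) ≠ 0 := by
  have := tprod_one_add_ne_zero_of_summable (f := fun n : ℕ+ ↦ s n / (n * x₁) - 1) (fun n ↦ by
    have hn1 : (n : ℂ) ≠ 0 := by exact_mod_cast n.ne_zero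
    simp [h0, ne_zero_of_re_pos h₁]) (hs.summable_div_sub_one h₁)
  simpa using this

lemma hasProd_rootFactor (h₁ : 0 < x₁.re) (h₂ : 0 < x₂.re) (hs : IsRootSeq x₁ w s)
    (hr : IsRootSeq x₂ w r) (h0 : ∀ n, r n ≠ 0) :
    HasProd (rootFactor x₁ x₂ s r) ((∏' n : ℕ+, s n / (n * x₁)) / ∏' n : ℕ+, r n / (n * x₂)) :=
  (hs.multipliable_div h₁).hasProd.div₀ (hr.multipliable_div h₂).hasProd
    (hr.tprod_div_ne_zero h₂ h0)

lemma IsRootSeq.hasProd_div_sq (h₁ : x₁ ≠ 0) (hs : IsRootSeq x₁ w s) :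
    HasProd (fun n : ℕ+ ↦ (s n / (n * x₁)) ^ 2) (sinhc (w / x₁)) := by
  refine (hasProd_sinhc (w / x₁)).congr_fun fun n ↦ ?_
  have hn1 : (n : ℂ) ≠ 0 := by exact_mod_cast n.ne_zero
  rw [div_pow, hs.1 n]
  field_simp

/-- Squaring removes the choice of roots: (s_n/(n x₁))² = 1 + (w/(n x₁))² is an Euler factor of
`sinhc (w / x₁)`. -/
theorem sinhRatioRoot_sq (h₁ : 0 < x₁.re) (h₂ : 0 < x₂.re) (hs : IsRootSeq x₁ w s)
    (hr : IsRootSeq x₂ w r) (h0 : ∀ n, r n ≠ 0) :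
    sinhRatioRoot x₁ x₂ s r ^ 2 = sinhRatio x₁ x₂ w := by
  have hx₁ := ne_zero_of_re_pos h₁
  have hx₂ := ne_zero_of_re_pos h₂
  have hpi : (Real.pi : ℂ) ≠ 0 := by exact_mod_cast Real.pi_ne_zero
  have e1 : (∏' n : ℕ+, s n / (n * x₁)) ^ 2 = sinhc (w / x₁) :=
    ((hs.multipliable_div h₁).hasProd.pow 2).unique (hs.hasProd_div_sq hx₁)
  have e2 : (∏' n : ℕ+, r n / (n * x₂)) ^ 2 = sinhc (w / x₂) :=
    ((hr.multipliable_div h₂).hasProd.pow 2).unique (hr.hasProd_div_sq hx₂)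
  have e3 : csqrt (x₂ / x₁) ^ 2 = x₂ / x₁ := by
    rw [csqrt, ← Complex.cpow_nat_mul]
    norm_num
  rw [sinhRatioRoot, (hasProd_rootFactor h₁ h₂ hs hr h0).tprod_eq, mul_pow, div_pow, e1, e2, e3,
    sinhRatio]
  split_ifs with hw
  · simp [hw, sinhc]
  · rw [sinhc, sinhc, if_neg (div_ne_zero hw hx₁), if_neg (div_ne_zero hw hx₂), mul_div_assoc,
      mul_div_assoc]
    field_simp

theorem tprod_etaFactor_div (h₁ : 0 < x₁.re) (h₂ : 0 < x₂.re) (ht : 0 < (x₁ / x₂).re)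
    (hw : ∀ n k : ℕ, 1 ≤ n → x₂ ^ 2 * (n : ℂ) ^ 2 + x₁ ^ 2 * (k : ℂ) ^ 2 ≠ -w ^ 2)
    (hs : IsRootSeq x₁ w s) (hr : IsRootSeq x₂ w r) (h0 : ∀ n, r n ≠ 0) :
    (∏' n : ℕ+, etaFactor x₂ s n) / (∏' n : ℕ+, etaFactor x₁ r n) =
      (x₁ / x₂) ^ (Real.pi * w ^ 2 / (2 * x₁ * x₂)) * sinhRatioRoot x₁ x₂ s r *
        Complex.exp (Real.pi / 12 * (x₁ / x₂ - x₂ / x₁) +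
          Real.pi * ∑' n : ℕ+, rootDiff x₁ x₂ s r n) := by
  have hx₁ := ne_zero_of_re_pos h₁
  have hx₂ := ne_zero_of_re_pos h₂
  have hinv : (x₁ / x₂)⁻¹ = x₂ / x₁ := inv_div _ _
  have ht' : 0 < (x₂ / x₁).re := hinv ▸ re_inv_pos ht
  have hP : ∏' p, canonicalFactor x₁ x₂ (w ^ 2) p ≠ 0 := by
    refine tprod_canonicalFactor_ne_zero hx₂ ht fun p h ↦ hw p.2 p.1 p.2.pos ?_
    rw [latticeForm] at h
    linear_combination h
  have hF := multipliable_canonicalFactor hx₂ ht (w ^ 2)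
  have hs_row := hF.hasProd.prod_fiberwise
    fun n ↦ hasProd_canonicalFactor_row hx₁ hx₂ ht n (hs.1 n)
  -- The same double product taken by columns, which are rows for x₁ and x₂ interchanged.
  have hr_row := ((Equiv.prodComm ℕ+ ℕ+).hasProd_iff.mpr hF.hasProd).prod_fiberwise
    (g := fun n ↦ sinhc (r n / x₁) / sinhc (n * x₂ / x₁) *
      Complex.exp (-(w ^ 2 / (x₂ * x₁) * rowSum (x₂ / x₁) n))) fun n ↦ by
    refine (hasProd_canonicalFactor_row hx₂ hx₁ ht' n (hr.1 n)).congr_fun fun k ↦ ?_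
    simp only [Function.comp_apply, Equiv.prodComm_apply, Prod.swap_prod_mk, canonicalFactor,
      latticeForm_swap x₁ x₂ k n]
  have hA := (hs.multipliable_etaFactor h₁ ht).hasProd.div₀
    (hr.multipliable_etaFactor h₂ ht').hasProd (hr.tprod_etaFactor_ne_zero h₂ ht' hw)
  have hE := (hasProd_one_sub_exp ht).div₀ (hasProd_one_sub_exp ht') (Complex.exp_ne_zero _)
  have hR := (hasProd_rootFactor h₁ h₂ hs hr h0).multipliable.hasProd
  have hD := ((summable_rootDiff h₁ h₂ hs hr).hasSum.mul_left (Real.pi : ℂ)).cexp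
  have hC := hs_row.div₀ hr_row hP
  have hL := ((hasSum_rowSum_sub ht).mul_left (w ^ 2 / (x₁ * x₂))).cexp
  -- The factors are the quotient at w = 0, the root factors, the root differences, rows over
  -- columns (total value 1), and the correction for the order of summation. Their product equals
  -- the quotient of the eta factors for each n.
  have hB := (((hE.mul hR).mul hD).mul hC).mul hL
  rw [hA.unique (hB.congr_fun fun n ↦ ?_), div_self hP, mul_one, ← Complex.exp_sub, ← hinv,
    logEulerProd_sub ht, sinhRatioRoot, csqrt, ← hinv,
    Complex.cpow_def_of_ne_zero (inv_ne_zero (ne_zero_of_re_pos ht)),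
    Complex.cpow_def_of_ne_zero (ne_zero_of_re_pos ht), Complex.log_inv _ (arg_ne_pi_of_re_pos ht),
    Complex.exp_add, Complex.exp_add]
  · have e1 : -(Complex.log (x₁ / x₂) / 2) = -Complex.log (x₁ / x₂) * (1 / 2) := by ring
    have e2 : w ^ 2 / (x₁ * x₂) * (Real.pi / 2 * Complex.log (x₁ / x₂)) =
        Complex.log (x₁ / x₂) * (Real.pi * w ^ 2 / (2 * x₁ * x₂)) := by
      field_simp
    rw [e1, e2]
    ring
  · rw [etaFactor_eq hx₁ hx₂ ht, etaFactor_eq hx₂ hx₁ ht', rootFactor, hinv]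
    simp only [Function.comp_apply]
    have e : Complex.exp (-(Real.pi * (s n / x₂ - n * x₁ / x₂))) =
      Complex.exp (Real.pi * rootDiff x₁ x₂ s r n) *
        Complex.exp (-(Real.pi * (r n / x₁ - n * x₂ / x₁))) := by
      rw [← Complex.exp_add, rootDiff]
      congr 1
      ring
    have e' : Complex.exp (w ^ 2 / (x₁ * x₂) * (rowSum (x₁ / x₂) n - rowSum (x₂ / x₁) n)) *
        Complex.exp (-(w ^ 2 / (x₁ * x₂) * rowSum (x₁ / x₂) n)) =
        Complex.exp (-(w ^ 2 / (x₂ * x₁) * rowSum (x₂ / x₁) n)) := by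
      rw [← Complex.exp_add, mul_comm x₂ x₁]
      congr 1
      ring
    have n1 := Complex.exp_ne_zero (-(Real.pi * (r n / x₁ - n * x₂ / x₁)))
    have n3 := Complex.exp_ne_zero (-(w ^ 2 / (x₁ * x₂) * rowSum (x₁ / x₂) n))
    have n4 := Complex.exp_ne_zero
      (w ^ 2 / (x₁ * x₂) * (rowSum (x₁ / x₂) n - rowSum (x₂ / x₁) n))
    rw [e]
    generalize Complex.exp (-(Real.pi * (r n / x₁ - n * x₂ / x₁))) = a1 at *
    generalize Complex.exp (-(w ^ 2 / (x₂ * x₁) * rowSum (x₂ / x₁) n)) = a2 at *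
    generalize Complex.exp (-(w ^ 2 / (x₁ * x₂) * rowSum (x₁ / x₂) n)) = a3 at *
    generalize Complex.exp (w ^ 2 / (x₁ * x₂) * (rowSum (x₁ / x₂) n - rowSum (x₂ / x₁) n)) = a4 at *
    generalize sinhc (r n / x₁) / sinhc (n * x₂ / x₁) = a5 at *
    generalize sinhc (s n / x₂) / sinhc (n * x₁ / x₂) = a6 at *
    generalize r n / (n * x₂) = a7 at *
    generalize s n / (n * x₁) = a8 at *
    subst e'
    field_simp

end transformation

/-! ### The case w = 0 and real parameters -/

theorem tprod_one_sub_exp_div {t : ℂ} (ht : 0 < t.re) :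
    (∏' n : ℕ+, (1 - Complex.exp (-(2 * Real.pi * n * t)))) /
        (∏' n : ℕ+, (1 - Complex.exp (-(2 * Real.pi * n * t⁻¹)))) =
      csqrt t⁻¹ * Complex.exp (Real.pi / 12 * (t - t⁻¹)) := by
  rw [(hasProd_one_sub_exp ht).tprod_eq, (hasProd_one_sub_exp (re_inv_pos ht)).tprod_eq,
    ← Complex.exp_sub, logEulerProd_sub ht, Complex.exp_add, csqrt,
    Complex.cpow_def_of_ne_zero (inv_ne_zero (ne_zero_of_re_pos ht)),
    Complex.log_inv _ (arg_ne_pi_of_re_pos ht)]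
  congr 2
  ring

section real

lemma csqrt_ofReal {x : ℝ} (hx : 0 ≤ x) : csqrt (x : ℂ) = (√x : ℝ) := by
  rw [csqrt, Real.sqrt_eq_rpow, Complex.ofReal_cpow hx]
  push_cast
  rfl

lemma isRootSeq_ofReal_sqrt (a v : ℝ) :
    IsRootSeq (a : ℂ) v (fun n ↦ ((√((n : ℝ) ^ 2 * a ^ 2 + v ^ 2) : ℝ) : ℂ)) := by
  have h (n : ℕ+) : 0 ≤ (n : ℝ) ^ 2 * a ^ 2 + v ^ 2 := by positivity
  refine ⟨fun n ↦ ?_, Eventually.of_forall fun n ↦ ?_⟩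
  · have := congrArg (Complex.ofReal) (Real.sq_sqrt (h n))
    push_cast at this ⊢
    exact this
  · simp only [← csqrt_ofReal (h n)]
    push_cast
    rfl

/-- Real parts of the partial products show that the real product converges too, so its value is a
genuine limit. -/
lemma Multipliable.ofReal_tprod {f : ℕ+ → ℝ} {g : ℕ+ → ℂ} (hfg : ∀ n, g n = f n)
    (hg : Multipliable g) : ∏' n, g n = ((∏' n, f n : ℝ) : ℂ) := by
  obtain rfl : g = fun n ↦ (f n : ℂ) := funext hfg
  obtain ⟨a, ha⟩ := hg
  have hre : HasProd f a.re := by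
    refine ((Complex.continuous_re.tendsto a).comp ha).congr fun t ↦ ?_
    simp only [Function.comp_apply, ← Complex.ofReal_prod, Complex.ofReal_re]
  rw [hre.tprod_eq]
  exact (hre.map Complex.ofRealHom Complex.continuous_ofReal).tprod_eq

end real

theorem tprod_sqrt_div {a b v : ℝ} (ha : 0 < a) (hb : 0 < b) (hv : v ≠ 0) :
    (∏' n : ℕ+, (1 - Real.exp (-(2 * Real.pi / b) * √((n : ℝ) ^ 2 * a ^ 2 + v ^ 2)))) /
        (∏' n : ℕ+, (1 - Real.exp (-(2 * Real.pi / a) * √((n : ℝ) ^ 2 * b ^ 2 + v ^ 2)))) =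
      (a / b) ^ (Real.pi * v ^ 2 / (2 * a * b)) *
        √(Real.sinh (Real.pi * v / a) / Real.sinh (Real.pi * v / b)) *
        Real.exp (Real.pi / 12 * (a / b - b / a) +
          Real.pi * ∑' n : ℕ+, (√(b ^ 2 * (n : ℝ) ^ 2 + v ^ 2) / a -
            √(a ^ 2 * (n : ℝ) ^ 2 + v ^ 2) / b - b * n / a + a * n / b)) := by
  have h₁ : 0 < (a : ℂ).re := by simpa
  have h₂ : 0 < (b : ℂ).re := by simpa
  have ht : 0 < ((a : ℂ) / b).re := by
    rw [← Complex.ofReal_div, Complex.ofReal_re]; positivity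
  have ht' : 0 < ((b : ℂ) / a).re := by
    rw [← Complex.ofReal_div, Complex.ofReal_re]; positivity
  set s : ℕ+ → ℝ := fun n ↦ √((n : ℝ) ^ 2 * a ^ 2 + v ^ 2) with hs_def
  set r : ℕ+ → ℝ := fun n ↦ √((n : ℝ) ^ 2 * b ^ 2 + v ^ 2) with hr_def
  have hs := isRootSeq_ofReal_sqrt a v
  have hr := isRootSeq_ofReal_sqrt b v
  have hr0 (n : ℕ+) : ((r n : ℝ) : ℂ) ≠ 0 := by
    have : 0 < r n := Real.sqrt_pos.mpr (by positivity)
    exact_mod_cast this.ne'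
  have hw (n k : ℕ) (_ : 1 ≤ n) :
      (b : ℂ) ^ 2 * (n : ℂ) ^ 2 + (a : ℂ) ^ 2 * (k : ℂ) ^ 2 ≠ -(v : ℂ) ^ 2 := by
    have : (0 : ℝ) < b ^ 2 * (n : ℝ) ^ 2 + a ^ 2 * (k : ℝ) ^ 2 + v ^ 2 := by positivity
    intro h
    have h' : b ^ 2 * (n : ℝ) ^ 2 + a ^ 2 * (k : ℝ) ^ 2 = -v ^ 2 := by exact_mod_cast h
    linarith
  have eA := (hs.multipliable_etaFactor h₁ ht).ofReal_tprod
    (f := fun n ↦ 1 - Real.exp (-(2 * Real.pi / b) * s n)) fun n ↦ by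
      rw [etaFactor]; push_cast; rfl
  have eB := (hr.multipliable_etaFactor h₂ ht').ofReal_tprod
    (f := fun n ↦ 1 - Real.exp (-(2 * Real.pi / a) * r n)) fun n ↦ by
      rw [etaFactor]; push_cast; rfl
  have eR := (hasProd_rootFactor h₁ h₂ hs hr hr0).multipliable.ofReal_tprod
    (f := fun n ↦ (s n / (n * a)) / (r n / (n * b))) fun n ↦ by
      rw [rootFactor]; push_cast; rfl
  have eD : ∑' n, rootDiff (a : ℂ) b (fun n ↦ (s n : ℂ)) (fun n ↦ (r n : ℂ)) n =
      ((∑' n : ℕ+, (√(b ^ 2 * (n : ℝ) ^ 2 + v ^ 2) / a -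
            √(a ^ 2 * (n : ℝ) ^ 2 + v ^ 2) / b - b * n / a + a * n / b) : ℝ) : ℂ) := by
    rw [Complex.ofReal_tsum]
    refine tsum_congr fun n ↦ ?_
    rw [rootDiff, hs_def, hr_def, mul_comm (b ^ 2), mul_comm (a ^ 2)]
    push_cast
    rfl
  set q : ℝ := √(b / a) * ∏' n : ℕ+, (s n / (n * a)) / (r n / (n * b)) with hq
  have eQ : sinhRatioRoot (a : ℂ) b (fun n ↦ (s n : ℂ)) (fun n ↦ (r n : ℂ)) = (q : ℂ) := by
    rw [sinhRatioRoot, eR, ← Complex.ofReal_div, csqrt_ofReal (by positivity), hq]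
    push_cast
    rfl
  -- Nonnegativity singles out q among the two square roots of the sinh ratio.
  have hq0 : 0 ≤ q := mul_nonneg (Real.sqrt_nonneg _) (tprod_nonneg fun n ↦ by positivity)
  have hq2 : q = √(Real.sinh (Real.pi * v / a) / Real.sinh (Real.pi * v / b)) := by
    have h := sinhRatioRoot_sq h₁ h₂ hs hr hr0
    rw [eQ, sinhRatio, if_neg (by exact_mod_cast hv)] at h
    have h' : q ^ 2 = Real.sinh (Real.pi * v / a) / Real.sinh (Real.pi * v / b) := by
      exact_mod_cast h
    rw [← h', Real.sqrt_sq hq0]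
  have main := tprod_etaFactor_div h₁ h₂ ht hw hs hr hr0
  rw [eA, eB, eD, eQ, hq2] at main
  have ec : ((a : ℂ) / b) ^ ((Real.pi : ℂ) * (v : ℂ) ^ 2 / (2 * a * b)) =
      (((a / b) ^ (Real.pi * v ^ 2 / (2 * a * b)) : ℝ) : ℂ) := by
    rw [Complex.ofReal_cpow (by positivity)]
    push_cast
    rfl
  rw [ec] at main
  simp only [hs_def, hr_def] at main
  exact_mod_cast main

theorem proposition4 :
    -- the general formula
    (∀ x₁ x₂ w : ℂ, 0 < x₁.re → 0 < x₂.re → 0 < (x₁ / x₂).re →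
      (∀ n k : ℕ, 1 ≤ n → x₂ ^ 2 * (n : ℂ) ^ 2 + x₁ ^ 2 * (k : ℂ) ^ 2 ≠ -w ^ 2) →
      ∀ s r : ℕ+ → ℂ, IsRootSeq x₁ w s → IsRootSeq x₂ w r →
        Multipliable (etaFactor x₂ s) ∧
        Multipliable (etaFactor x₁ r) ∧
        (∏' n : ℕ+, etaFactor x₁ r n) ≠ 0 ∧
        Summable (rootDiff x₁ x₂ s r) ∧
        Multipliable (rootFactor x₁ x₂ s r) ∧
        sinhRatioRoot x₁ x₂ s r ^ 2 = sinhRatio x₁ x₂ w ∧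
        (∏' n : ℕ+, etaFactor x₂ s n) / (∏' n : ℕ+, etaFactor x₁ r n) =
          (x₁ / x₂) ^ (Real.pi * w ^ 2 / (2 * x₁ * x₂)) * sinhRatioRoot x₁ x₂ s r *
            Complex.exp (Real.pi / 12 * (x₁ / x₂ - x₂ / x₁) +
              Real.pi * ∑' n : ℕ+, rootDiff x₁ x₂ s r n)) ∧
    -- for real parameters all roots are the nonnegative ones
    (∀ a b v : ℝ, 0 < a → 0 < b → v ≠ 0 →
      (∏' n : ℕ+, (1 - Real.exp (-(2 * Real.pi / b) * √((n : ℝ) ^ 2 * a ^ 2 + v ^ 2)))) /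
          (∏' n : ℕ+, (1 - Real.exp (-(2 * Real.pi / a) * √((n : ℝ) ^ 2 * b ^ 2 + v ^ 2)))) =
        (a / b) ^ (Real.pi * v ^ 2 / (2 * a * b)) *
          √(Real.sinh (Real.pi * v / a) / Real.sinh (Real.pi * v / b)) *
          Real.exp (Real.pi / 12 * (a / b - b / a) +
            Real.pi * ∑' n : ℕ+, (√(b ^ 2 * (n : ℝ) ^ 2 + v ^ 2) / a -
              √(a ^ 2 * (n : ℝ) ^ 2 + v ^ 2) / b - b * n / a + a * n / b))) ∧
    -- the case `w = 0`
    (∀ x₁ x₂ : ℂ, 0 < x₁.re → 0 < x₂.re → 0 < (x₁ / x₂).re →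
      (∏' n : ℕ+, (1 - Complex.exp (-(2 * Real.pi / x₂) * (n * x₁)))) /
          (∏' n : ℕ+, (1 - Complex.exp (-(2 * Real.pi / x₁) * (n * x₂)))) =
        csqrt (x₂ / x₁) * Complex.exp (Real.pi / 12 * (x₁ / x₂ - x₂ / x₁))) ∧
    (∀ τ : ℂ, 0 < τ.im →
      ModularForm.eta (-1 / τ) = csqrt (-Complex.I * τ) * ModularForm.eta τ) := by

  refine ⟨fun x₁ x₂ w h₁ h₂ ht hw s r hs hr ↦ ?_, fun a b v ha hb hv ↦ tprod_sqrt_div ha hb hv,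
    fun x₁ x₂ h₁ h₂ ht ↦ ?_, eta_neg_one_div⟩
  · have h0 (n : ℕ+) : r n ≠ 0 := by
      intro h
      have := hr.1 n
      rw [h] at this
      -- The instance k = 0 of the hypothesis is exactly r_n² ≠ 0.
      refine hw n 0 n.pos ?_
      push_cast
      linear_combination -this
    have ht' : 0 < (x₂ / x₁).re := inv_div x₁ x₂ ▸ re_inv_pos ht
    exact ⟨hs.multipliable_etaFactor h₁ ht, hr.multipliable_etaFactor h₂ ht',
      hr.tprod_etaFactor_ne_zero h₂ ht' hw, summable_rootDiff h₁ h₂ hs hr,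
      (hasProd_rootFactor h₁ h₂ hs hr h0).multipliable, sinhRatioRoot_sq h₁ h₂ hs hr h0,
      tprod_etaFactor_div h₁ h₂ ht hw hs hr h0⟩
  · have h := tprod_one_sub_exp_div ht
    rw [inv_div] at h
    rw [← h]
    congr 1 <;> refine tprod_congr fun n ↦ ?_ <;> congr 2 <;> ring
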